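/- Let $\mathbb{S}^2$ be the unit sphere of $\mathbb{R}^3$ and let $(e_0,e_1,e_2)$ be an orthonormal basis of $\mathbb{R}^3$. Let $c=e_0$, let $S$ be the open hemisphere with center $c$, and let $L$ and $H$ be the intersections with $S$ of the great circles in the planes $\mathrm{span}(e_0,e_1)$ and $\mathrm{span}(e_0,e_2)$ (so these are two great circles meeting orthogonally at $c$). Each $p\in S$ is written uniquely as $$p=\cos\theta_p\cos\varphi_p\,e_0+\cos\theta_p\sin\varphi_p\,e_1+\sin\theta_p\,e_2,\qquad -\tfrac{\pi}{2}<\theta_p,\varphi_p<\tfrac{\pi}{2},$$ and for $-\frac{\pi}{2}<\theta<\frac{\pi}{2}$ let $C_\theta=\{p\in S:\theta_p=\theta\}$ (the distance curves with axis $L$). A set in $\mathbb{S}^2$ is called spherically convex if it is contained in an open hemisphere and contains, with any two of its points, the shorter great-circle arc connecting them. Let $K\subset S$ be a compact, spherically convex set with nonempty interior in $\mathbb{S}^2$, such that $K\cap C_\theta$ is connected (possibly empty) for every $\theta$. Let $\ell(\theta)$ denote the angular length of $K\cap C_\theta$, that is, the length of the (possibly empty or degenerate) interval $\{\varphi_p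 : p\in K\cap C_\theta\}$, with $\ell(\theta)=0$ if $K\cap C_\theta$ is empty or a single point. Assume that $K$ has the angular monotonicity property: $\ell$ is nonincreasing on $[0,\frac{\pi}{2})$ and nondecreasing on $(-\frac{\pi}{2},0]$. **Theorem.** The Steiner symmetral $$\sigma_{L,H}(K)=\left\{p\in S:\ K\cap C_{\theta_p}\neq\emptyset,\ |\varphi_p|\le \tfrac12\,\ell(\theta_p)\right\},$$ obtained by replacing each nonempty arc $K\cap C_\theta$ by the closed arc of $C_\theta$ of the same length centered at the point $C_\theta\cap H$, is spherically convex. -/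

import Mathlib

noncomputable section

/-- Euclidean three-space. -/
abbrev E3 : Type := EuclideanSpace ℝ (Fin 3)

/-- The unit sphere `𝕊²`, with its subspace topology. -/
abbrev S2 : Type := Metric.sphere (0 : E3) 1

namespace Sph

/-- The open hemisphere with center `c`: the points at spherical distance
`arccos ⟪c, p⟫ < π / 2` from `c`. -/
def openHemisphere (c : S2) : Set S2 :=
  {p | Real.arccos (inner ℝ (c : E3) (p : E3)) < Real.pi / 2}

/-- The segment `[x, y]_s`. For distinct non-antipodal `x`, `y` the unit vectors that are
nonnegative combinations of `x` and `y` form the shorter closed arc with endpoints `x`, `y` of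
the great circle through `x` and `y`; for `x = y` this is `{x}`. -/
def segment (x y : S2) : Set S2 :=
  {z | ∃ a b : ℝ, 0 ≤ a ∧ 0 ≤ b ∧ (z : E3) = a • (x : E3) + b • (y : E3)}

/-- Spherical convexity: contained in an open hemisphere and closed under spherical segments. -/
def IsConvex (K : Set S2) : Prop :=
  (∃ c : S2, K ⊆ openHemisphere c) ∧ ∀ x ∈ K, ∀ y ∈ K, segment x y ⊆ K

/-- Spherical convex bodies (convex disks) of `𝕊²`. -/
structure IsConvexBody (K : Set S2) : Prop where
  isCompact : IsCompact K
  isConvex : IsConvex K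
  nonempty_interior : (interior K).Nonempty

/- Below, an orthonormal basis `e` of three-space encodes the data `(S, L, H)`: the center of the
open hemisphere `S` is `c = e 0`, and `L`, `H` are the intersections with `S` of the great circles
in the planes spanned by `e 0, e 1` and by `e 0, e 2`. Every pair of great circles meeting
orthogonally at `c` is obtained in this way. -/

/-- The center `c` of the hemisphere `S`. -/
def center (e : OrthonormalBasis (Fin 3) ℝ E3) : S2 := ⟨e 0, by simp⟩

/-- The open hemisphere `S` centered at `c`. -/
def hemisphere (e : OrthonormalBasis (Fin 3) ℝ E3) : Set S2 := openHemisphere (center e)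

/-- `θ_p`: the signed spherical distance of `p` from the great circle of `L`. -/
def theta (e : OrthonormalBasis (Fin 3) ℝ E3) (p : S2) : ℝ :=
  Real.arcsin (inner ℝ (e 2) (p : E3))

/-- `φ_p`, for `p` in `S`: the signed spherical distance from `H` of the orthogonal projection of
`p` onto `L`, so that `p = cos θ cos φ • e 0 + cos θ sin φ • e 1 + sin θ • e 2`. -/
def phi (e : OrthonormalBasis (Fin 3) ℝ E3) (p : S2) : ℝ :=
  Real.arctan (inner ℝ (e 1) (p : E3) / inner ℝ (e 0) (p : E3))

/-- The distance curve `C_θ` with axis `L`. -/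
def distanceCurve (e : OrthonormalBasis (Fin 3) ℝ E3) (t : ℝ) : Set S2 :=
  {p | p ∈ hemisphere e ∧ theta e p = t}

/-- The angular length of a (possibly empty or degenerate) arc of a distance curve: the length of
its interval of `φ`-coordinates, i.e. `|φ_p - φ_q|` for an arc with endpoints `p`, `q`, and `0` for
a point or the empty set. -/
def angularLength (e : OrthonormalBasis (Fin 3) ℝ E3) (A : Set S2) : ℝ :=
  Metric.diam (phi e '' A)

/-- The connectedness property: every distance curve with axis `L` meets `X` in a connected (or
empty) set. -/
def ConnectednessProperty (e : OrthonormalBasis (Fin 3) ℝ E3) (X : Set S2) : Prop :=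
  ∀ t : ℝ, IsPreconnected (X ∩ distanceCurve e t)

/-- The angular monotonicity property, for a set with the connectedness property. -/
structure AngularMonotonicity (e : OrthonormalBasis (Fin 3) ℝ E3) (K : Set S2) : Prop where
  connected : ConnectednessProperty e K
  antitoneOn : AntitoneOn (fun t => angularLength e (K ∩ distanceCurve e t))
    (Set.Ico 0 (Real.pi / 2))
  monotoneOn : MonotoneOn (fun t => angularLength e (K ∩ distanceCurve e t))
    (Set.Ioc (-(Real.pi / 2)) 0)

/-- The Steiner symmetral `σ_{L,H}(X)`: each nonempty arc `X ∩ C_t` is replaced by the closed arc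
of `C_t` with the same angular length (hence the same length, which is `cos t` times the angular
length) centered at the point `φ = 0` of `C_t`, i.e. at `C_t ∩ H`; a singleton is replaced by
`C_t ∩ H`, and curves that miss `X` stay empty. -/
def steinerSymmetral (e : OrthonormalBasis (Fin 3) ℝ E3) (X : Set S2) : Set S2 :=
  {p | ∃ t : ℝ, p ∈ distanceCurve e t ∧ (X ∩ distanceCurve e t).Nonempty ∧
    |phi e p| ≤ angularLength e (X ∩ distanceCurve e t) / 2}

end Sph

end

/-! Project centrally onto the cylinder around the axis `e 2`: a point of the hemisphere becomes
`(cos φ, sin φ, t)` with `t = tan θ`. Non-vertical great circles become graphs `t = A cos φ + B sin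
φ`, and segments become nonnegative combinations of these vectors. The body becomes a
`ConvexProfile` with section widths `w t`, and the symmetral is `|φ| ≤ w t / 2` over the nonempty
sections.

By reflection it suffices to treat a combination with height `≥ 0` and angle `φ ≥ 0`. Since `w`
decreases upwards from `t = 0`, it is enough to find some height at or above that of the combination
with `2 * φ ≤ w` there (`exists_height_ge`). Endpoints of negative height are first raised to `0`,
which only enlarges their sections.

For heights `s₁ ≤ s₂` the candidate lies either on the arc spanning the symmetrized upper section or
on the arc joining the right ends of the two symmetrized sections. The second case is the core. The
arcs joining first to first and last to last points of the original sections have the form `φ = c ±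
arcsin (k t)`, and `two_mul_arcsin_sub_arcsin_ge` shows that their distance is at least that of the
symmetrized arcs. Monotonicity of `w` also yields `le_mul_cos`-type control: each of these arcs is a
graph over heights. -/

open Set

/-! ### Arcs as graphs `c - arcsin (k t)` over the height. -/

/-- The derivative of `t ↦ arcsin (k t)`. -/
theorem hasDerivAt_arcsin_mul {k t : ℝ} (h : |k * t| < 1) :
    HasDerivAt (fun s => Real.arcsin (k * s)) (k / √(1 - (k * t) ^ 2)) t := by
  obtain ⟨h1, h2⟩ := abs_lt.1 h
  have := (Real.hasDerivAt_arcsin h1.ne' h2.ne).comp t ((hasDerivAt_id t).const_mul k)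
  refine (this.congr_deriv ?_)
  simp; ring

/-- The derivative of `t ↦ k / √(1 - (k t) ^ 2)`. -/
theorem hasDerivAt_div_sqrt_one_sub_sq {k t : ℝ} (h : |k * t| < 1) :
    HasDerivAt (fun s => k / √(1 - (k * s) ^ 2)) (t * (k / √(1 - (k * t) ^ 2)) ^ 3) t := by
  have hpos : 0 < 1 - (k * t) ^ 2 := by
    have := (sq_lt_one_iff_abs_lt_one (k * t)).2 h
    linarith
  have h1 : HasDerivAt (fun s => 1 - (k * s) ^ 2) (-(2 * (k * t) * k)) t := by
    have := (((hasDerivAt_id t).const_mul k).pow 2).const_sub 1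
    refine this.congr_deriv ?_
    simp
  have h2 := (h1.sqrt hpos.ne')
  have h3 := (hasDerivAt_const t k).div h2 (Real.sqrt_pos.2 hpos).ne'
  refine h3.congr_deriv ?_
  have hs := (Real.sqrt_pos.2 hpos)
  field_simp
  ring

/-- If the second derivative of `F` at a critical point is negative, then this point is not a
local minimum. -/
theorem not_isLocalMin_of_deriv_neg {F F' : ℝ → ℝ} {t c : ℝ}
    (hF : ∀ᶠ s in nhds t, HasDerivAt F (F' s) s) (hF' : HasDerivAt F' c t) (h0 : F' t = 0)
    (hc : c < 0) : ¬ IsLocalMin F t := by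
  intro hmin
  have hev : deriv F =ᶠ[nhds t] F' := hF.mono fun s hs => hs.deriv
  have hd : deriv (deriv F) t = c := by rw [hev.deriv_eq, hF'.deriv]
  have hmax : IsLocalMax F t :=
    isLocalMax_of_deriv_deriv_neg (by rw [hd]; exact hc) (by rw [hev.eq_of_nhds, h0])
      hF.self_of_nhds.continuousAt
  -- A point that is both a local minimum and a local maximum makes `F` locally constant, so the
  -- second derivative vanishes.
  have hconst : F =ᶠ[nhds t] fun _ => F t := by
    filter_upwards [hmin, hmax] with s h1 h2 using le_antisymm h2 h1
  have : deriv (deriv F) t = 0 := by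
    rw [hconst.deriv.deriv_eq]; simp
  linarith

/-- The comparison of sums of functions `arcsin (k t)` that have equal increments on an
interval. -/
theorem two_mul_arcsin_sub_arcsin_ge {s₁ s₂ a b k t : ℝ} (h0 : 0 ≤ s₁) (hk : 0 < k)
    (ha : |a| * s₂ ≤ 1) (hb : |b| * s₂ ≤ 1) (hks : k * s₂ ≤ 1) (ht : t ∈ Icc s₁ s₂)
    (heq : 2 * Real.arcsin (k * s₁) - Real.arcsin (a * s₁) - Real.arcsin (b * s₁) =
      2 * Real.arcsin (k * s₂) - Real.arcsin (a * s₂) - Real.arcsin (b * s₂)) :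
    2 * Real.arcsin (k * s₂) - Real.arcsin (a * s₂) - Real.arcsin (b * s₂) ≤
      2 * Real.arcsin (k * t) - Real.arcsin (a * t) - Real.arcsin (b * t) := by
  set F : ℝ → ℝ := fun t => 2 * Real.arcsin (k * t) - Real.arcsin (a * t) - Real.arcsin (b * t)
    with hF
  change F s₁ = F s₂ at heq
  change F s₂ ≤ F t
  by_contra! hlt
  have hcont : Continuous F := by fun_prop
  -- A value below the common end value forces an interior minimum, where all three arcsines are
  -- differentiable.
  obtain ⟨m, hm, hmin⟩ := isCompact_Icc.exists_isMinOn ⟨t, ht⟩ hcont.continuousOn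
  have hFm : F m < F s₂ := lt_of_le_of_lt (hmin ht) hlt
  have hm1 : s₁ < m := lt_of_le_of_ne hm.1 (by rintro rfl; linarith)
  have hm2 : m < s₂ := lt_of_le_of_ne hm.2 (by rintro rfl; linarith)
  have hmpos : 0 < m := by linarith
  have key : ∀ c : ℝ, |c| * s₂ ≤ 1 → ∀ s ∈ Ioo s₁ s₂, |c * s| < 1 := by
    intro c hc s hs
    have hs0 : 0 < s := by linarith [hs.1]
    rw [abs_mul, abs_of_pos hs0]
    rcases (abs_nonneg c).eq_or_lt with h | h
    · rw [← h]; simp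
    · nlinarith [hs.2]
  have hk' : |k| * s₂ ≤ 1 := by rwa [abs_of_pos hk]
  have hloc : IsLocalMin F m := hmin.isLocalMin (Icc_mem_nhds hm1 hm2)
  set D : ℝ → ℝ → ℝ := fun c s => c / √(1 - (c * s) ^ 2) with hD
  have hderiv : ∀ s ∈ Ioo s₁ s₂, HasDerivAt F (2 * D k s - D a s - D b s) s := fun s hs =>
    (((hasDerivAt_arcsin_mul (key k hk' s hs)).const_mul 2).sub
      (hasDerivAt_arcsin_mul (key a ha s hs))).sub (hasDerivAt_arcsin_mul (key b hb s hs))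
  have hmem : m ∈ Ioo s₁ s₂ := ⟨hm1, hm2⟩
  have hder2 : HasDerivAt (fun s => 2 * D k s - D a s - D b s)
      (2 * (m * D k m ^ 3) - m * D a m ^ 3 - m * D b m ^ 3) m :=
    (((hasDerivAt_div_sqrt_one_sub_sq (key k hk' m hmem)).const_mul 2).sub
      (hasDerivAt_div_sqrt_one_sub_sq (key a ha m hmem))).sub
      (hasDerivAt_div_sqrt_one_sub_sq (key b hb m hmem))
  have hcrit : 2 * D k m - D a m - D b m = 0 := hloc.hasDerivAt_eq_zero (hderiv m hmem)
  have hsq : ∀ c : ℝ, |c| * s₂ ≤ 1 → 0 < 1 - (c * m) ^ 2 := fun c hc => by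
    have := (sq_lt_one_iff_abs_lt_one (c * m)).2 (key c hc m hmem)
    linarith
  have hinj : ∀ c d : ℝ, |c| * s₂ ≤ 1 → |d| * s₂ ≤ 1 → D c m = D d m → c = d := by
    intro c d hc hd h
    -- `m * D c m` is `tan (arcsin (c * m))`, which is injective in `c`.
    have h' : Real.tan (Real.arcsin (c * m)) = Real.tan (Real.arcsin (d * m)) := by
      rw [Real.tan_arcsin, Real.tan_arcsin]
      have := congrArg (· * m) h
      simp only [hD] at this
      rw [div_mul_eq_mul_div, div_mul_eq_mul_div] at this
      exact this
    have hmemc : ∀ c : ℝ, |c| * s₂ ≤ 1 →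
        Real.arcsin (c * m) ∈ Ioo (-(Real.pi / 2)) (Real.pi / 2) := fun c hc => by
      have := abs_lt.1 (key c hc m hmem)
      exact ⟨Real.neg_pi_div_two_lt_arcsin.2 this.1, Real.arcsin_lt_pi_div_two.2 this.2⟩
    have h2 := Real.injOn_tan (hmemc c hc) (hmemc d hd) h'
    have hc1 := abs_le.1 (key c hc m hmem).le
    have hd1 := abs_le.1 (key d hd m hmem).le
    have h3 := (Real.arcsin_inj hc1.1 hc1.2 hd1.1 hd1.2).1 h2
    exact mul_right_cancel₀ hmpos.ne' h3
  have hne : D a m ≠ D b m := by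
    intro hab
    have hka : k = a := hinj k a hk' ha (by linarith)
    have hkb : k = b := hinj k b hk' hb (by linarith)
    have : ∀ s, F s = 0 := fun s => by simp only [hF, ← hka, ← hkb]; ring
    rw [this, this] at hFm
    exact lt_irrefl _ hFm
  refine not_isLocalMin_of_deriv_neg (Filter.eventually_of_mem (Ioo_mem_nhds hm1 hm2) hderiv)
    hder2 hcrit ?_ hloc
  have hDk : 0 < D k m := div_pos hk (Real.sqrt_pos.2 (hsq k hk'))
  -- Convexity of the cube: at a critical point `D k m` is the mean of `D a m` and `D b m`, so the
  -- second derivative is negative.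
  have hid : 2 * (m * D k m ^ 3) - m * D a m ^ 3 - m * D b m ^ 3 =
      -(m * D k m * (D a m - D b m) ^ 2 * (3 / 2)) := by
    have : D k m = (D a m + D b m) / 2 := by linarith
    rw [this]; ring
  rw [hid, neg_lt_zero]
  have : 0 < (D a m - D b m) ^ 2 := by
    have := sub_ne_zero.2 hne
    positivity
  positivity

/-- Existence of a curve `c - arcsin (k t)` with a prescribed increment. -/
theorem exists_arcsin_sub_arcsin_eq {s₁ s₂ d : ℝ} (h0 : 0 ≤ s₁) (h12 : s₁ < s₂)
    (hd0 : 0 ≤ d) (hdpi : d ≤ Real.pi) (hd : s₁ ≤ s₂ * Real.cos d) :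
    ∃ k, 0 ≤ k ∧ k * s₂ ≤ 1 ∧ Real.arcsin (k * s₂) - Real.arcsin (k * s₁) = d := by
  have hs2 : 0 < s₂ := by linarith
  have hc : ContinuousOn (fun k => Real.arcsin (k * s₂) - Real.arcsin (k * s₁))
      (Icc 0 (1 / s₂)) := by
    apply Continuous.continuousOn; fun_prop
  -- The increment runs from `0` at `k = 0` to `arccos (s₁ / s₂)` at `k = 1 / s₂`, where the great
  -- circle has its top at height `s₂`.
  have hmem : d ∈ Icc ((fun k => Real.arcsin (k * s₂) - Real.arcsin (k * s₁)) 0)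
      ((fun k => Real.arcsin (k * s₂) - Real.arcsin (k * s₁)) (1 / s₂)) := by
    constructor
    · simpa using hd0
    · have h1 : 1 / s₂ * s₂ = 1 := by field_simp
      have h2 : 1 / s₂ * s₁ = s₁ / s₂ := by ring
      simp only [h1, h2, Real.arcsin_one, ← Real.arccos_eq_pi_div_two_sub_arcsin]
      rw [← Real.arccos_cos hd0 hdpi]
      apply Real.arccos_le_arccos
      rw [div_le_iff₀ hs2]; linarith
  obtain ⟨k, hk, hkd⟩ := intermediate_value_Icc (by positivity) hc hmem
  exact ⟨k, hk.1, (le_div_iff₀ hs2).1 hk.2, hkd⟩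

theorem exists_arcsin_sub_arcsin_eq_of_abs {s₁ s₂ d : ℝ} (h0 : 0 ≤ s₁) (h12 : s₁ < s₂)
    (hdpi : |d| ≤ Real.pi) (hd : s₁ ≤ s₂ * Real.cos d) :
    ∃ k, |k| * s₂ ≤ 1 ∧ Real.arcsin (k * s₂) - Real.arcsin (k * s₁) = d := by
  obtain ⟨k, hk0, hk1, hk2⟩ := exists_arcsin_sub_arcsin_eq h0 h12 (abs_nonneg d) hdpi
    (by rwa [Real.cos_abs])
  rcases le_total 0 d with h | h
  · exact ⟨k, by rwa [abs_of_nonneg hk0], by rw [hk2, abs_of_nonneg h]⟩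
  · refine ⟨-k, by rwa [abs_neg, abs_of_nonneg hk0], ?_⟩
    rw [abs_of_nonpos h] at hk2
    rw [neg_mul, neg_mul, Real.arcsin_neg, Real.arcsin_neg]
    linarith

/-- The points `φ = c - arcsin (k t)` lie on a great circle. -/
theorem mul_sin_arcsin_sub_arcsin {s₁ s₂ t k : ℝ} (hk : k ≠ 0) (h1 : |k * s₁| ≤ 1)
    (h2 : |k * s₂| ≤ 1) (ht : |k * t| ≤ 1) :
    t * Real.sin (Real.arcsin (k * s₂) - Real.arcsin (k * s₁)) =
      s₂ * Real.sin (Real.arcsin (k * t) - Real.arcsin (k * s₁)) +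
        s₁ * Real.sin (Real.arcsin (k * s₂) - Real.arcsin (k * t)) := by
  have e1 := Real.sin_arcsin (abs_le.1 h1).1 (abs_le.1 h1).2
  have e2 := Real.sin_arcsin (abs_le.1 h2).1 (abs_le.1 h2).2
  have e := Real.sin_arcsin (abs_le.1 ht).1 (abs_le.1 ht).2
  apply mul_left_cancel₀ hk
  simp only [Real.sin_sub, e1, e2, e]
  ring

/-! ### Trigonometric chord inequalities. -/

/-- The chord through the points with angles `f₁ > f₂` and heights `s₁ ≤ s₂` lies above the
points of height `s₁` and angle at most `f₁` in absolute value. -/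
theorem chord_ge_of_abs_le_left {f₁ f₂ s₁ s₂ x : ℝ} (h2 : 0 ≤ f₂) (h12 : f₂ ≤ f₁)
    (h1 : f₁ < Real.pi / 2) (hs1 : 0 ≤ s₁)
    (hc : s₁ * Real.cos f₂ ≤ s₂ * Real.cos f₁) (hx : |x| ≤ f₁) :
    s₁ * Real.sin (f₁ - f₂) ≤ s₂ * Real.sin (f₁ - x) + s₁ * Real.sin (x - f₂) := by
  obtain ⟨hx1, hx2⟩ := abs_le.1 hx
  -- Half angles let `2 * sin h` factor out, leaving `s₁ * cos (d - h) ≤ s₂ * cos h`.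
  obtain ⟨h, rfl⟩ : ∃ h, x = f₁ - 2 * h := ⟨(f₁ - x) / 2, by ring⟩
  obtain ⟨d, rfl⟩ : ∃ d, f₂ = f₁ - d := ⟨f₁ - f₂, by ring⟩
  have e1 : f₁ - (f₁ - 2 * h) = 2 * h := by ring
  have e2 : f₁ - 2 * h - (f₁ - d) = (d - h) - h := by ring
  have e3 : f₁ - (f₁ - d) = (d - h) + h := by ring
  rw [e1, e2, e3, Real.sin_two_mul, Real.sin_add (d - h), Real.sin_sub (d - h)]
  have hcf : 0 < Real.cos f₁ := Real.cos_pos_of_mem_Ioo ⟨by linarith, h1⟩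
  have hch : 0 ≤ Real.cos h := Real.cos_nonneg_of_mem_Icc ⟨by linarith, by linarith⟩
  have hsh : 0 ≤ Real.sin h := Real.sin_nonneg_of_nonneg_of_le_pi (by linarith) (by linarith)
  have hsd : 0 ≤ Real.sin d := Real.sin_nonneg_of_nonneg_of_le_pi (by linarith) (by linarith)
  have hsfh : 0 ≤ Real.sin (f₁ - h) :=
    Real.sin_nonneg_of_nonneg_of_le_pi (by linarith) (by linarith)
  have hid : Real.cos (f₁ - d) * Real.cos h - Real.cos f₁ * Real.cos (d - h) =
      Real.sin d * Real.sin (f₁ - h) := by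
    simp only [Real.cos_sub, Real.sin_sub]; ring
  have hmain : s₁ * Real.cos (d - h) ≤ s₂ * Real.cos h := by
    refine le_of_mul_le_mul_left ?_ hcf
    have i1 := mul_le_mul_of_nonneg_right hc hch
    have i2 := mul_nonneg hs1 (mul_nonneg hsd hsfh)
    rw [← hid] at i2
    nlinarith
  have := mul_le_mul_of_nonneg_left hmain hsh
  nlinarith

/-- The chord through the points with angles `f₁ > f₂` and heights `s₁ ≤ s₂` lies above the
points of height `s₂` and angle at most `f₂` in absolute value. -/
theorem chord_ge_of_abs_le_right {f₁ f₂ s₁ s₂ x : ℝ} (h12 : f₂ ≤ f₁)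
    (h1 : f₁ < Real.pi / 2) (hs2 : 0 ≤ s₂)
    (hc : s₁ * Real.cos f₂ ≤ s₂ * Real.cos f₁) (hx : |x| ≤ f₂) :
    s₂ * Real.sin (f₁ - f₂) ≤ s₂ * Real.sin (f₁ - x) + s₁ * Real.sin (x - f₂) := by
  obtain ⟨hx1, hx2⟩ := abs_le.1 hx
  -- Here the factor `2 * sin h` leaves `s₁ * cos h ≤ s₂ * cos (d + h)`.
  obtain ⟨h, rfl⟩ : ∃ h, x = f₂ - 2 * h := ⟨(f₂ - x) / 2, by ring⟩
  obtain ⟨d, rfl⟩ : ∃ d, f₁ = f₂ + d := ⟨f₁ - f₂, by ring⟩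
  have e1 : f₂ + d - (f₂ - 2 * h) = (d + h) + h := by ring
  have e2 : f₂ - 2 * h - f₂ = -(2 * h) := by ring
  have e3 : f₂ + d - f₂ = (d + h) - h := by ring
  rw [e1, e2, e3, Real.sin_neg, Real.sin_two_mul, Real.sin_add (d + h), Real.sin_sub (d + h)]
  have hcf : 0 < Real.cos f₂ := Real.cos_pos_of_mem_Ioo ⟨by linarith, by linarith⟩
  have hch : 0 ≤ Real.cos h := Real.cos_nonneg_of_mem_Icc ⟨by linarith, by linarith⟩
  have hsh : 0 ≤ Real.sin h := Real.sin_nonneg_of_nonneg_of_le_pi (by linarith) (by linarith)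
  have hsd : 0 ≤ Real.sin d := Real.sin_nonneg_of_nonneg_of_le_pi (by linarith) (by linarith)
  have hsfh : 0 ≤ Real.sin (f₂ - h) :=
    Real.sin_nonneg_of_nonneg_of_le_pi (by linarith) (by linarith)
  have hid : Real.cos (d + h) * Real.cos f₂ - Real.cos (f₂ + d) * Real.cos h =
      Real.sin d * Real.sin (f₂ - h) := by
    simp only [Real.cos_add, Real.sin_sub]; ring
  have hmain : s₁ * Real.cos h ≤ s₂ * Real.cos (d + h) := by
    refine le_of_mul_le_mul_left ?_ hcf
    have i1 := mul_le_mul_of_nonneg_right hc hch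
    have i2 := mul_nonneg hs2 (mul_nonneg hsd hsfh)
    rw [← hid] at i2
    nlinarith
  have := mul_le_mul_of_nonneg_left hmain hsh
  nlinarith

/-! ### Convexity in cylindrical coordinates. -/

/-- `(cos φ, sin φ)` is the combination of `(cos φ₁, sin φ₁)` and `(cos φ₂, sin φ₂)` with
coefficients `a, b ≥ 0`. -/
structure IsAngularComb (φ₁ φ₂ φ a b : ℝ) : Prop where
  left_nonneg : 0 ≤ a
  right_nonneg : 0 ≤ b
  abs_lt : |φ| < Real.pi / 2
  cos_eq : Real.cos φ = a * Real.cos φ₁ + b * Real.cos φ₂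
  sin_eq : Real.sin φ = a * Real.sin φ₁ + b * Real.sin φ₂

namespace IsAngularComb

variable {φ₁ φ₂ φ a b m : ℝ}

theorem symm (h : IsAngularComb φ₁ φ₂ φ a b) : IsAngularComb φ₂ φ₁ φ b a :=
  ⟨h.2, h.1, h.3, by rw [h.4]; ring, by rw [h.5]; ring⟩

theorem neg (h : IsAngularComb φ₁ φ₂ φ a b) : IsAngularComb (-φ₁) (-φ₂) (-φ) a b :=
  ⟨h.1, h.2, by simpa using h.3, by simpa using h.4, by simp only [Real.sin_neg, h.5]; ring⟩

/-- `sin (m - φ)` is linear in `(cos φ, sin φ)`, so it inherits nonnegativity from the two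
endpoints. -/
theorem le (h : IsAngularComb φ₁ φ₂ φ a b) (_hm : m < Real.pi / 2) (h1 : |φ₁| ≤ m)
    (h2 : |φ₂| ≤ m) : φ ≤ m := by
  by_contra! hlt
  have hφ := _root_.abs_lt.1 h.abs_lt
  have h1' := abs_le.1 h1
  have h2' := abs_le.1 h2
  have e : Real.sin (m - φ) = a * Real.sin (m - φ₁) + b * Real.sin (m - φ₂) := by
    simp only [Real.sin_sub, h.cos_eq, h.sin_eq]; ring
  have i : Real.sin (m - φ) < 0 := Real.sin_neg_of_neg_of_neg_pi_lt (by linarith) (by linarith)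
  have i1 : 0 ≤ Real.sin (m - φ₁) :=
    Real.sin_nonneg_of_nonneg_of_le_pi (by linarith) (by linarith)
  have i2 : 0 ≤ Real.sin (m - φ₂) :=
    Real.sin_nonneg_of_nonneg_of_le_pi (by linarith) (by linarith)
  have := mul_nonneg h.1 i1
  have := mul_nonneg h.2 i2
  linarith

end IsAngularComb

/-- A spherically convex set in the open hemisphere, in the coordinates `φ` and `t = tan θ`,
together with the angular widths `w t` of its sections. -/
structure ConvexProfile (M : ℝ → ℝ → Prop) (w : ℝ → ℝ) : Prop where
  abs_phi_lt : ∀ {φ t}, M φ t → |φ| < Real.pi / 2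
  comb : ∀ {φ₁ t₁ φ₂ t₂ φ a b}, M φ₁ t₁ → M φ₂ t₂ → IsAngularComb φ₁ φ₂ φ a b →
    M φ (a * t₁ + b * t₂)
  sub_le : ∀ {φ ψ t}, M φ t → M ψ t → ψ - φ ≤ w t
  exists_eq : ∀ {φ t}, M φ t → ∃ α β, M α t ∧ M β t ∧ β - α = w t
  anti : ∀ {s t}, 0 ≤ s → s ≤ t → w t ≤ w s
  mono : ∀ {s t}, s ≤ t → t ≤ 0 → w s ≤ w t
  exists_zero : ∃ φ, M φ 0

namespace ConvexProfile

variable {M : ℝ → ℝ → Prop} {w : ℝ → ℝ}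

/-- Reflection fixing `H`: it carries statements about last points of sections to first points. -/
theorem mirror (H : ConvexProfile M w) : ConvexProfile (fun φ t => M (-φ) t) w where
  abs_phi_lt h := by simpa using H.abs_phi_lt h
  comb h1 h2 hc := H.comb h1 h2 hc.neg
  sub_le h1 h2 := by linarith [H.sub_le h2 h1]
  exists_eq h := by
    obtain ⟨α, β, h1, h2, h3⟩ := H.exists_eq h
    exact ⟨-β, -α, by simpa using h2, by simpa using h1, by linarith⟩
  anti := H.anti
  mono := H.mono
  exists_zero := by
    obtain ⟨φ, h⟩ := H.exists_zero
    exact ⟨-φ, by simpa using h⟩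

/-- Reflection fixing `L`: it exchanges `anti` and `mono`. -/
theorem flip (H : ConvexProfile M w) :
    ConvexProfile (fun φ t => M φ (-t)) (fun t => w (-t)) where
  abs_phi_lt h := H.abs_phi_lt h
  comb {φ₁ t₁ φ₂ t₂ φ a b} h1 h2 hc := by
    have := H.comb h1 h2 hc
    rwa [show a * -t₁ + b * -t₂ = -(a * t₁ + b * t₂) by ring] at this
  sub_le h1 h2 := H.sub_le h1 h2
  exists_eq h := H.exists_eq h
  anti h1 h2 := H.mono (by linarith) (by linarith)
  mono h1 h2 := H.anti (by linarith) (by linarith)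
  exists_zero := by simpa using H.exists_zero

theorem width_nonneg (H : ConvexProfile M w) {φ t : ℝ} (h : M φ t) : 0 ≤ w t := by
  simpa using H.sub_le h h

theorem width_lt_pi (H : ConvexProfile M w) {φ t : ℝ} (h : M φ t) : w t < Real.pi := by
  obtain ⟨α, β, hα, hβ, e⟩ := H.exists_eq h
  have h1 := abs_lt.1 (H.abs_phi_lt hα)
  have h2 := abs_lt.1 (H.abs_phi_lt hβ)
  linarith

/-- Points of great-circle arcs, in terms of weights with a common denominator. -/
theorem of_weights (H : ConvexProfile M w) {φ₁ t₁ φ₂ t₂ φ t : ℝ} (h1 : M φ₁ t₁) (h2 : M φ₂ t₂)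
    (hφ : |φ| < Real.pi / 2) (hne : Real.sin (φ₂ - φ₁) ≠ 0)
    (ha : 0 ≤ Real.sin (φ₂ - φ) / Real.sin (φ₂ - φ₁))
    (hb : 0 ≤ Real.sin (φ - φ₁) / Real.sin (φ₂ - φ₁))
    (ht : t * Real.sin (φ₂ - φ₁) = t₁ * Real.sin (φ₂ - φ) + t₂ * Real.sin (φ - φ₁)) :
    M φ t := by
  have hc : IsAngularComb φ₁ φ₂ φ _ _ := ⟨ha, hb, hφ, by
      rw [div_mul_eq_mul_div, div_mul_eq_mul_div, ← add_div, eq_div_iff hne]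
      simp only [Real.sin_sub]; ring, by
      rw [div_mul_eq_mul_div, div_mul_eq_mul_div, ← add_div, eq_div_iff hne]
      simp only [Real.sin_sub]; ring⟩
  have := H.comb h1 h2 hc
  rwa [div_mul_eq_mul_div, div_mul_eq_mul_div, ← add_div, mul_comm _ t₁, mul_comm _ t₂, ← ht,
    mul_div_cancel_right₀ _ hne] at this

/-- The equation `ht` is that of the graph `A cos φ + B sin φ` through the two given points. -/
theorem arc (H : ConvexProfile M w) {φ₁ t₁ φ₂ t₂ φ t : ℝ} (h1 : M φ₁ t₁) (h2 : M φ₂ t₂)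
    (h12 : φ₁ < φ₂) (hφ : φ ∈ Icc φ₁ φ₂)
    (ht : t * Real.sin (φ₂ - φ₁) = t₁ * Real.sin (φ₂ - φ) + t₂ * Real.sin (φ - φ₁)) :
    M φ t := by
  have b1 := abs_lt.1 (H.abs_phi_lt h1)
  have b2 := abs_lt.1 (H.abs_phi_lt h2)
  have hpos : 0 < Real.sin (φ₂ - φ₁) :=
    Real.sin_pos_of_pos_of_lt_pi (by linarith) (by linarith)
  refine H.of_weights h1 h2 (abs_lt.2 ⟨by linarith [hφ.1], by linarith [hφ.2]⟩) hpos.ne'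
    (div_nonneg ?_ hpos.le) (div_nonneg ?_ hpos.le) ht
  · exact Real.sin_nonneg_of_nonneg_of_le_pi (by linarith [hφ.2]) (by linarith [hφ.1])
  · exact Real.sin_nonneg_of_nonneg_of_le_pi (by linarith [hφ.1]) (by linarith [hφ.2])

theorem vertical (H : ConvexProfile M w) {φ t₁ t₂ t : ℝ} (h1 : M φ t₁) (h2 : M φ t₂)
    (ht : t ∈ Icc t₁ t₂) : M φ t := by
  obtain ⟨a, b, ha, hb, hab, rfl⟩ : t ∈ segment ℝ t₁ t₂ := by
    rwa [segment_eq_Icc (ht.1.trans ht.2)]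
  exact H.comb h1 h2 ⟨ha, hb, H.abs_phi_lt h1, by rw [← add_mul, hab, one_mul],
    by rw [← add_mul, hab, one_mul]⟩

/-- The points of an arc that is a graph over an interval of heights. -/
theorem arcsin_arc (H : ConvexProfile M w) {φ₁ φ₂ s₁ s₂ t k : ℝ} (h1 : M φ₁ s₁) (h2 : M φ₂ s₂)
    (h0 : 0 ≤ s₁) (h12 : s₁ < s₂) (ht : t ∈ Icc s₁ s₂) (hk : |k| * s₂ ≤ 1)
    (hd : Real.arcsin (k * s₂) - Real.arcsin (k * s₁) = φ₁ - φ₂) :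
    M (φ₂ + Real.arcsin (k * s₂) - Real.arcsin (k * t)) t := by
  have b1 := abs_lt.1 (H.abs_phi_lt h1)
  have b2 := abs_lt.1 (H.abs_phi_lt h2)
  have habs : ∀ s ∈ Icc s₁ s₂, |k * s| ≤ 1 := fun s hs => by
    rw [abs_mul, abs_of_nonneg (h0.trans hs.1)]
    exact (mul_le_mul_of_nonneg_left hs.2 (abs_nonneg k)).trans hk
  have hs1 := habs s₁ ⟨le_rfl, h12.le⟩
  have hs2 := habs s₂ ⟨h12.le, le_rfl⟩
  -- The sign of `k` decides whether the angle grows or shrinks with height; `k = 0` is a meridian.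
  rcases lt_trichotomy k 0 with hk0 | rfl | hk0
  · have e := mul_sin_arcsin_sub_arcsin hk0.ne hs1 hs2 (habs t ht)
    have i1 : Real.arcsin (k * t) ≤ Real.arcsin (k * s₁) :=
      Real.arcsin_le_arcsin (by nlinarith [ht.1])
    have i2 : Real.arcsin (k * s₂) ≤ Real.arcsin (k * t) :=
      Real.arcsin_le_arcsin (by nlinarith [ht.2])
    have i3 : Real.arcsin (k * s₂) < Real.arcsin (k * s₁) :=
      Real.strictMonoOn_arcsin (abs_le.1 hs2) (abs_le.1 hs1) (by nlinarith)
    refine H.arc h1 h2 (by linarith) ⟨by linarith, by linarith⟩ ?_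
    rw [show φ₂ - φ₁ = -(Real.arcsin (k * s₂) - Real.arcsin (k * s₁)) by linarith,
      show φ₂ - (φ₂ + Real.arcsin (k * s₂) - Real.arcsin (k * t)) =
        -(Real.arcsin (k * s₂) - Real.arcsin (k * t)) by linarith,
      show φ₂ + Real.arcsin (k * s₂) - Real.arcsin (k * t) - φ₁ =
        -(Real.arcsin (k * t) - Real.arcsin (k * s₁)) by linarith]
    simp only [Real.sin_neg]
    linarith
  · simp only [zero_mul, Real.arcsin_zero, sub_zero, add_zero] at hd ⊢
    obtain rfl : φ₁ = φ₂ := by linarith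
    exact H.vertical h1 h2 ht
  · have e := mul_sin_arcsin_sub_arcsin hk0.ne' hs1 hs2 (habs t ht)
    have i1 : Real.arcsin (k * s₁) ≤ Real.arcsin (k * t) :=
      Real.arcsin_le_arcsin (by nlinarith [ht.1])
    have i2 : Real.arcsin (k * t) ≤ Real.arcsin (k * s₂) :=
      Real.arcsin_le_arcsin (by nlinarith [ht.2])
    have i3 : Real.arcsin (k * s₁) < Real.arcsin (k * s₂) :=
      Real.strictMonoOn_arcsin (abs_le.1 hs1) (abs_le.1 hs2) (by nlinarith)
    refine H.arc h2 h1 (by linarith) ⟨by linarith, by linarith⟩ ?_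
    rw [show φ₁ - φ₂ = Real.arcsin (k * s₂) - Real.arcsin (k * s₁) by linarith,
      show φ₁ - (φ₂ + Real.arcsin (k * s₂) - Real.arcsin (k * t)) =
        Real.arcsin (k * t) - Real.arcsin (k * s₁) by linarith,
      show φ₂ + Real.arcsin (k * s₂) - Real.arcsin (k * t) - φ₂ =
        Real.arcsin (k * s₂) - Real.arcsin (k * t) by linarith]
    exact e

/-- The arc between two points of the same height. -/
theorem symmetric_arc (H : ConvexProfile M w) {α β f s u t : ℝ} (hα : M α s) (hβ : M β s)
    (hf : β - α = 2 * f) (hf0 : 0 < f) (hu : |u| ≤ f)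
    (ht : t * Real.cos f = s * Real.cos u) : M ((α + β) / 2 + u) t := by
  have hu' := abs_le.1 hu
  refine H.arc hα hβ (by linarith) ⟨by linarith, by linarith⟩ ?_
  rw [hf, show β - ((α + β) / 2 + u) = f - u by linarith,
    show (α + β) / 2 + u - α = f + u by linarith, Real.sin_two_mul, Real.sin_sub, Real.sin_add]
  linear_combination 2 * Real.sin f * ht

/-- A wide arc at a height forces wide sections above it. -/
theorem two_mul_le_width (H : ConvexProfile M w) {φ s u t : ℝ} (h : M φ s) (hu0 : 0 ≤ u)
    (hu : u ≤ w s / 2) (ht : t * Real.cos (w s / 2) = s * Real.cos u) :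
    (∃ ψ, M ψ t) ∧ 2 * u ≤ w t := by
  obtain ⟨α, β, hα, hβ, e⟩ := H.exists_eq h
  have hpi := H.width_lt_pi h
  rcases (hu0.trans hu).eq_or_lt with h0 | h0
  · have hu : u = w s / 2 := by linarith
    have : 0 < Real.cos u := Real.cos_pos_of_mem_Ioo ⟨by linarith, by linarith⟩
    rw [hu] at ht
    obtain rfl : t = s := mul_right_cancel₀ (by rw [← hu]; exact this.ne') ht
    exact ⟨⟨φ, h⟩, by linarith⟩
  · have h1 := H.symmetric_arc (u := u) (t := t) hα hβ (f := w s / 2) (by linarith) h0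
      (by rwa [abs_of_nonneg hu0]) ht
    have h2 := H.symmetric_arc (u := -u) (t := t) hα hβ (f := w s / 2) (by linarith) h0
      (by rwa [abs_neg, abs_of_nonneg hu0]) (by rwa [Real.cos_neg])
    exact ⟨⟨_, h1⟩, by linarith [H.sub_le h2 h1]⟩

/-- Otherwise the arc spanning the section at `s₁` would still be wider than `w s₂` when it reaches
height `s₂`. -/
theorem mul_cos_le_mul_cos (H : ConvexProfile M w) {φ₁ φ₂ s₁ s₂ : ℝ} (h1 : M φ₁ s₁)
    (h2 : M φ₂ s₂) (h0 : 0 ≤ s₁) (h12 : s₁ ≤ s₂) :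
    s₁ * Real.cos (w s₂ / 2) ≤ s₂ * Real.cos (w s₁ / 2) := by
  by_contra! hlt
  have hw2 := H.width_nonneg h2
  have hp2 := H.width_lt_pi h2
  have hw1 := H.width_nonneg h1
  have hp1 := H.width_lt_pi h1
  have hc1 : 0 < Real.cos (w s₁ / 2) :=
    Real.cos_pos_of_mem_Ioo ⟨by linarith, by linarith⟩
  have hs1 : 0 < s₁ := by
    refine lt_of_le_of_ne h0 ?_
    rintro rfl
    nlinarith
  have hx0 : 0 ≤ s₂ * Real.cos (w s₁ / 2) / s₁ := by
    have := h0.trans h12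
    positivity
  have hx1 : s₂ * Real.cos (w s₁ / 2) / s₁ < Real.cos (w s₂ / 2) := by
    rw [div_lt_iff₀ hs1]; linarith
  have hx2 : Real.cos (w s₁ / 2) ≤ s₂ * Real.cos (w s₁ / 2) / s₁ := by
    rw [le_div_iff₀ hs1]; nlinarith
  -- The offset from its midpoint at which that arc has height `s₂`.
  set u := Real.arccos (s₂ * Real.cos (w s₁ / 2) / s₁) with hu
  have hcu : Real.cos u = s₂ * Real.cos (w s₁ / 2) / s₁ :=
    Real.cos_arccos (by linarith) (hx1.le.trans (Real.cos_le_one _))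
  have hu1 : u ≤ w s₁ / 2 := by
    rw [← Real.arccos_cos (x := w s₁ / 2) (by linarith) (by linarith)]
    exact Real.arccos_le_arccos hx2
  have hu2 : w s₂ / 2 < u := by
    rw [← Real.arccos_cos (x := w s₂ / 2) (by linarith) (by linarith)]
    exact Real.arccos_lt_arccos (by linarith) hx1 (Real.cos_le_one _)
  have := (H.two_mul_le_width (t := s₂) h1 (Real.arccos_nonneg _) hu1
    (by rw [hcu]; field_simp)).2
  linarith

/-- An arc that starts at the last point of a section cannot rise at first. -/
theorem le_mul_cos (H : ConvexProfile M w) {φ₁ φ₂ s₁ s₂ : ℝ} (h1 : M φ₁ s₁) (h2 : M φ₂ s₂)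
    (h0 : 0 ≤ s₁) (h12 : s₁ < s₂) (hlt : φ₂ < φ₁) (hmax : ∀ φ, M φ s₂ → φ ≤ φ₂) :
    s₁ ≤ s₂ * Real.cos (φ₁ - φ₂) := by
  by_contra! hcon
  have b1 := abs_lt.1 (H.abs_phi_lt h1)
  have b2 := abs_lt.1 (H.abs_phi_lt h2)
  have hs2 : 0 < s₂ := by linarith
  obtain ⟨x, hx⟩ : ∃ x, φ₁ - φ₂ = 2 * x := ⟨(φ₁ - φ₂) / 2, by ring⟩
  have hsin : 0 < Real.sin (φ₁ - φ₂) :=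
    Real.sin_pos_of_pos_of_lt_pi (by linarith) (by linarith)
  have hsx : 0 < Real.sin x := Real.sin_pos_of_pos_of_lt_pi (by linarith) (by linarith)
  have hcx : 0 < Real.cos x := Real.cos_pos_of_mem_Ioo ⟨by linarith, by linarith⟩
  -- At offset `v` from `φ₂` the arc has height `s₂ * cos v + b * sin v`, so `b` is its initial
  -- slope.
  set b := (s₁ - s₂ * Real.cos (φ₁ - φ₂)) / Real.sin (φ₁ - φ₂) with hb
  have hbpos : 0 < b := div_pos (by linarith) hsin
  have hbe : b * Real.sin (φ₁ - φ₂) = s₁ - s₂ * Real.cos (φ₁ - φ₂) :=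
    div_mul_cancel₀ _ hsin.ne'
  -- A rising arc has its top at offset `y` and returns to height `s₂` at `2 * y`, beyond the last
  -- point of the section.
  set y := Real.arctan (b / s₂) with hy
  have hypos : 0 < y := Real.arctan_pos.2 (div_pos hbpos hs2)
  have hyx : y < x := by
    rw [← Real.arctan_tan (x := x) (by linarith) (by linarith)]
    refine Real.arctan_strictMono ?_
    rw [Real.tan_eq_sin_div_cos, div_lt_div_iff₀ hs2 hcx]
    rw [hx, Real.sin_two_mul, Real.cos_two_mul] at hbe
    have := Real.sin_sq_add_cos_sq x
    nlinarith
  have hcy : 0 < Real.cos y := Real.cos_arctan_pos _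
  have hty : s₂ * Real.sin y = b * Real.cos y := by
    have : Real.tan y = b / s₂ := Real.tan_arctan _
    rw [Real.tan_eq_sin_div_cos, div_eq_div_iff hcy.ne' hs2.ne'] at this
    linarith
  have hM : M (φ₂ + 2 * y) s₂ := by
    refine H.arc h2 h1 hlt ⟨by linarith, by linarith⟩ ?_
    rw [show φ₁ - (φ₂ + 2 * y) = (φ₁ - φ₂) - 2 * y by ring,
      show φ₂ + 2 * y - φ₂ = 2 * y by ring, Real.sin_sub (φ₁ - φ₂), Real.sin_two_mul,
      Real.cos_two_mul]
    linear_combination 2 * Real.sin y * Real.cos y * hbe +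
      2 * Real.sin (φ₁ - φ₂) * Real.sin y * hty -
      2 * s₂ * Real.sin (φ₁ - φ₂) * Real.sin_sq_add_cos_sq y
  linarith [hmax _ hM]

/-- Intermediate values of the height along the arc joining the two points. -/
theorem exists_mem_of_le (H : ConvexProfile M w) {φ₀ φ₁ s t : ℝ} (h0 : M φ₀ 0) (h1 : M φ₁ t)
    (hs : s ∈ Icc 0 t) : ∃ φ, M φ s := by
  wlog hle : φ₀ ≤ φ₁ generalizing M φ₀ φ₁
  · obtain ⟨φ, hφ⟩ := this H.mirror (φ₀ := -φ₀) (φ₁ := -φ₁) (by simpa using h0)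
      (by simpa using h1) (by linarith)
    exact ⟨-φ, hφ⟩
  rcases hle.eq_or_lt with rfl | hlt
  · exact ⟨_, H.vertical h0 h1 hs⟩
  have b1 := abs_lt.1 (H.abs_phi_lt h0)
  have b2 := abs_lt.1 (H.abs_phi_lt h1)
  have hpos : 0 < Real.sin (φ₁ - φ₀) :=
    Real.sin_pos_of_pos_of_lt_pi (by linarith) (by linarith)
  have hc : ContinuousOn (fun φ => t * Real.sin (φ - φ₀) / Real.sin (φ₁ - φ₀)) (Icc φ₀ φ₁) := by
    apply Continuous.continuousOn; fun_prop
  obtain ⟨φ, hφ, he⟩ := intermediate_value_Icc hle hc (show s ∈ Icc _ _ by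
    simpa [mul_div_assoc, div_self hpos.ne'] using hs)
  refine ⟨φ, H.arc h0 h1 hlt hφ ?_⟩
  rw [← he]
  field_simp
  ring

end ConvexProfile

/-! ### Symmetrization of a convex profile. -/

namespace ConvexProfile

variable {M : ℝ → ℝ → Prop} {w : ℝ → ℝ}

/-- Sections at heights between those of two sections of widths `2 f₁ > 2 f₂` are at least as
wide as prescribed by the arc that joins the symmetrized end points. -/
theorem arcsin_le_width (H : ConvexProfile M w) {ψ₁ ψ₂ s₁ s₂ k t : ℝ} (h1 : M ψ₁ s₁)
    (h2 : M ψ₂ s₂) (h0 : 0 ≤ s₁) (h12 : s₁ < s₂) (ht : t ∈ Icc s₁ s₂) (hk0 : 0 < k)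
    (hk : k * s₂ ≤ 1)
    (hd : Real.arcsin (k * s₂) - Real.arcsin (k * s₁) = w s₁ / 2 - w s₂ / 2) :
    (∃ ψ, M ψ t) ∧ w s₂ + 2 * Real.arcsin (k * s₂) - 2 * Real.arcsin (k * t) ≤ w t := by
  obtain ⟨α₁, β₁, hα₁, hβ₁, e₁⟩ := H.exists_eq h1
  obtain ⟨α₂, β₂, hα₂, hβ₂, e₂⟩ := H.exists_eq h2
  have bα₁ := abs_lt.1 (H.abs_phi_lt hα₁)
  have bα₂ := abs_lt.1 (H.abs_phi_lt hα₂)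
  have bβ₁ := abs_lt.1 (H.abs_phi_lt hβ₁)
  have bβ₂ := abs_lt.1 (H.abs_phi_lt hβ₂)
  have hdpos : 0 < w s₁ / 2 - w s₂ / 2 := by
    rw [← hd]
    have hs2 : 0 < s₂ := by linarith
    have := mul_lt_mul_of_pos_left h12 hk0
    have := mul_pos hk0 hs2
    exact sub_pos.2 (Real.strictMonoOn_arcsin ⟨by nlinarith, by linarith⟩
      ⟨by linarith, hk⟩ ‹_›)
  have hB : 0 < β₁ - β₂ → s₁ ≤ s₂ * Real.cos (β₁ - β₂) := fun h =>
    H.le_mul_cos hβ₁ hβ₂ h0 h12 (by linarith) fun φ hφ => by linarith [H.sub_le hα₂ hφ]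
  have hA : 0 < α₂ - α₁ → s₁ ≤ s₂ * Real.cos (α₂ - α₁) := fun h => by
    have := H.mirror.le_mul_cos (φ₁ := -α₁) (φ₂ := -α₂) (by simpa using hα₁)
      (by simpa using hα₂) h0 h12 (by linarith) fun φ hφ => by linarith [H.sub_le hφ hβ₂]
    rwa [show -α₁ - -α₂ = α₂ - α₁ by ring] at this
  have hsum : (β₁ - β₂) + (α₂ - α₁) = 2 * (w s₁ / 2 - w s₂ / 2) := by linarith
  have hs2 : 0 < s₂ := by linarith
  -- If one end does not move inwards with height, the other moves inwards at least as far, so its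
  -- bound covers both.
  have hB' : s₁ ≤ s₂ * Real.cos (β₁ - β₂) := by
    rcases lt_or_ge 0 (β₁ - β₂) with h | h
    · exact hB h
    · refine (hA (by linarith)).trans (mul_le_mul_of_nonneg_left ?_ hs2.le)
      rw [← Real.cos_neg (β₁ - β₂)]
      exact Real.cos_le_cos_of_nonneg_of_le_pi (by linarith) (by linarith) (by linarith)
  have hA' : s₁ ≤ s₂ * Real.cos (α₂ - α₁) := by
    rcases lt_or_ge 0 (α₂ - α₁) with h | h
    · exact hA h
    · refine (hB (by linarith)).trans (mul_le_mul_of_nonneg_left ?_ hs2.le)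
      rw [← Real.cos_neg (α₂ - α₁)]
      exact Real.cos_le_cos_of_nonneg_of_le_pi (by linarith) (by linarith) (by linarith)
  obtain ⟨p, hp, hpd⟩ := exists_arcsin_sub_arcsin_eq_of_abs h0 h12
    (abs_le.2 ⟨by linarith, by linarith⟩) hB'
  obtain ⟨q, hq, hqd⟩ := exists_arcsin_sub_arcsin_eq_of_abs h0 h12
    (abs_le.2 ⟨by linarith, by linarith⟩) hA'
  have hMB := H.arcsin_arc hβ₁ hβ₂ h0 h12 ht hp hpd
  have hMA := H.mirror.arcsin_arc (φ₁ := -α₁) (φ₂ := -α₂) (by simpa using hα₁)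
    (by simpa using hα₂) h0 h12 ht hq (by linarith)
  have hwt := H.sub_le hMA hMB
  -- The increments for `p` and `q` add up to twice the one for `k`, by `hsum`.
  have := two_mul_arcsin_sub_arcsin_ge h0 hk0 hp hq hk ht (by linarith)
  exact ⟨⟨_, hMB⟩, by linarith⟩

/-- The height is read off on the arc spanning the upper symmetrized section if `φ ≤ w s₂ / 2`, and
otherwise on the arc joining the right ends of both; the chord inequalities place these above the
combination. -/
theorem exists_height_ge (H : ConvexProfile M w) {ψ₁ ψ₂ s₁ s₂ φ₁ φ₂ φ a b : ℝ} (h1 : M ψ₁ s₁)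
    (h2 : M ψ₂ s₂) (h0 : 0 ≤ s₁) (h12 : s₁ ≤ s₂) (hφ₁ : |φ₁| ≤ w s₁ / 2)
    (hφ₂ : |φ₂| ≤ w s₂ / 2) (hc : IsAngularComb φ₁ φ₂ φ a b) (hφ : 0 ≤ φ) :
    ∃ t, a * s₁ + b * s₂ ≤ t ∧ (∃ ψ, M ψ t) ∧ 2 * φ ≤ w t := by
  have hslope := H.mul_cos_le_mul_cos h1 h2 h0 h12
  have hw1 := H.width_nonneg h1
  have hp1 := H.width_lt_pi h1
  have hw2 := H.width_nonneg h2
  have hw12 := H.anti h0 h12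
  set f₁ := w s₁ / 2 with hf₁
  set f₂ := w s₂ / 2 with hf₂
  have hs2 : 0 ≤ s₂ := h0.trans h12
  have hf12 : f₂ ≤ f₁ := by linarith
  have hcf2 : 0 < Real.cos f₂ := Real.cos_pos_of_mem_Ioo ⟨by linarith, by linarith⟩
  have hφf : φ ≤ f₁ := hc.le (by linarith) hφ₁ (hφ₂.trans hf12)
  rcases le_or_gt φ f₂ with hle | hlt
  · refine ⟨s₂ * Real.cos φ / Real.cos f₂, ?_,
      H.two_mul_le_width h2 hφ hle (div_mul_cancel₀ _ hcf2.ne')⟩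
    have i1 : Real.cos f₁ ≤ Real.cos φ₁ := by
      rw [← Real.cos_abs φ₁]
      exact Real.cos_le_cos_of_nonneg_of_le_pi (abs_nonneg _) (by linarith) hφ₁
    have i2 : Real.cos f₂ ≤ Real.cos φ₂ := by
      rw [← Real.cos_abs φ₂]
      exact Real.cos_le_cos_of_nonneg_of_le_pi (abs_nonneg _) (by linarith) hφ₂
    rw [le_div_iff₀ hcf2, hc.cos_eq]
    have j1 := mul_le_mul_of_nonneg_left (hslope.trans (mul_le_mul_of_nonneg_left i1 hs2)) hc.1
    have j2 := mul_le_mul_of_nonneg_left (mul_le_mul_of_nonneg_left i2 hs2) hc.2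
    linarith
  · have hf12' : f₂ < f₁ := hlt.trans_le hφf
    have hs12 : s₁ < s₂ := lt_of_le_of_ne h12 (by rintro rfl; exact hf12'.ne rfl)
    have hsd : 0 < Real.sin (f₁ - f₂) :=
      Real.sin_pos_of_pos_of_lt_pi (by linarith) (by linarith)
    -- This makes the arc joining the right ends a graph over `[s₁, s₂]`; it follows from `hslope`
    -- and `cos f₁ ≤ cos (f₁ - f₂) * cos f₂`.
    have hnover : s₁ ≤ s₂ * Real.cos (f₁ - f₂) := by
      refine le_of_mul_le_mul_right ?_ hcf2
      refine hslope.trans ?_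
      rw [mul_assoc]
      refine mul_le_mul_of_nonneg_left ?_ hs2
      have e : Real.cos f₁ = Real.cos (f₁ - f₂) * Real.cos f₂ -
          Real.sin (f₁ - f₂) * Real.sin f₂ := by
        rw [← Real.cos_add, sub_add_cancel]
      have := mul_nonneg hsd.le (Real.sin_nonneg_of_nonneg_of_le_pi (x := f₂) (by linarith)
        (by linarith))
      linarith
    obtain ⟨k, hk0, hk1, hkd⟩ := exists_arcsin_sub_arcsin_eq h0 hs12 (by linarith)
      (by linarith) hnover
    have hkpos : 0 < k := by
      refine lt_of_le_of_ne hk0 ?_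
      rintro rfl
      simp only [zero_mul, sub_self] at hkd
      linarith
    have hcont : ContinuousOn (fun t => f₂ + Real.arcsin (k * s₂) - Real.arcsin (k * t))
        (Icc s₁ s₂) := by
      apply Continuous.continuousOn; fun_prop
    obtain ⟨t, ht, he⟩ := intermediate_value_Icc' h12 hcont
      (show φ ∈ Icc _ _ from ⟨by linarith, by linarith⟩)
    obtain ⟨hM, hw⟩ := H.arcsin_le_width h1 h2 h0 hs12 ht hkpos hk1 hkd
    simp only at he
    refine ⟨t, ?_, hM, by linarith⟩
    have habs : ∀ s ∈ Icc s₁ s₂, |k * s| ≤ 1 := fun s hs => by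
      rw [abs_of_nonneg (mul_nonneg hk0 (h0.trans hs.1))]
      exact (mul_le_mul_of_nonneg_left hs.2 hk0).trans hk1
    have e := mul_sin_arcsin_sub_arcsin hkpos.ne' (habs s₁ ⟨le_rfl, h12⟩)
      (habs s₂ ⟨h12, le_rfl⟩) (habs t ht)
    rw [hkd, show Real.arcsin (k * t) - Real.arcsin (k * s₁) = f₁ - φ by linarith,
      show Real.arcsin (k * s₂) - Real.arcsin (k * t) = φ - f₂ by linarith] at e
    refine le_of_mul_le_mul_right ?_ hsd
    rw [e]
    -- The chord height is linear in `(cos φ, sin φ)`, so comparing it at `φ₁` and `φ₂` suffices.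
    have i1 := mul_le_mul_of_nonneg_left
      (chord_ge_of_abs_le_left (by linarith) hf12 (by linarith) h0 hslope hφ₁) hc.1
    have i2 := mul_le_mul_of_nonneg_left
      (chord_ge_of_abs_le_right hf12 (by linarith) hs2 hslope hφ₂) hc.2
    have e1 : Real.sin (f₁ - φ) = a * Real.sin (f₁ - φ₁) + b * Real.sin (f₁ - φ₂) := by
      simp only [Real.sin_sub, hc.cos_eq, hc.sin_eq]; ring
    have e2 : Real.sin (φ - f₂) = a * Real.sin (φ₁ - f₂) + b * Real.sin (φ₂ - f₂) := by
      simp only [Real.sin_sub, hc.cos_eq, hc.sin_eq]; ring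
    rw [e1, e2]
    linarith

/-- Membership in the symmetrized profile. -/
theorem symmetrization_of_nonneg (H : ConvexProfile M w) {ψ₁ ψ₂ s₁ s₂ φ₁ φ₂ φ a b : ℝ}
    (h1 : M ψ₁ s₁) (h2 : M ψ₂ s₂) (hφ₁ : |φ₁| ≤ w s₁ / 2)
    (hφ₂ : |φ₂| ≤ w s₂ / 2) (hc : IsAngularComb φ₁ φ₂ φ a b) (hpos : 0 ≤ a * s₁ + b * s₂) :
    (∃ ψ, M ψ (a * s₁ + b * s₂)) ∧ |φ| ≤ w (a * s₁ + b * s₂) / 2 := by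
  wlog hφ : 0 ≤ φ generalizing φ₁ φ₂ φ
  · simpa using this (φ₁ := -φ₁) (φ₂ := -φ₂) (φ := -φ) (by simpa using hφ₁)
      (by simpa using hφ₂) hc.neg (by linarith)
  obtain ⟨χ, hχ⟩ := H.exists_zero
  -- The section at height `0` is nonempty and widest, so points below it may be lifted there; this
  -- only raises the combination.
  have hraise : ∀ {ψ s x : ℝ}, M ψ s → |x| ≤ w s / 2 →
      (∃ ψ', M ψ' (max s 0)) ∧ |x| ≤ w (max s 0) / 2 := by
    intro ψ s x h hx
    rcases le_total 0 s with hs | hs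
    · rw [max_eq_left hs]
      exact ⟨⟨ψ, h⟩, hx⟩
    · rw [max_eq_right hs]
      exact ⟨⟨χ, hχ⟩, by linarith [H.mono hs le_rfl]⟩
  obtain ⟨⟨ψ₁', h1'⟩, hφ₁'⟩ := hraise h1 hφ₁
  obtain ⟨⟨ψ₂', h2'⟩, hφ₂'⟩ := hraise h2 hφ₂
  obtain ⟨t, ht, ⟨ψ, hψ⟩, hw⟩ : ∃ t, a * max s₁ 0 + b * max s₂ 0 ≤ t ∧ (∃ ψ, M ψ t) ∧
      2 * φ ≤ w t := by
    rcases le_total (max s₁ 0) (max s₂ 0) with hle | hle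
    · exact H.exists_height_ge h1' h2' (le_max_right _ _) hle hφ₁' hφ₂' hc hφ
    · obtain ⟨t, ht, h⟩ :=
        H.exists_height_ge h2' h1' (le_max_right _ _) hle hφ₂' hφ₁' hc.symm hφ
      exact ⟨t, by linarith, h⟩
  have hle : a * s₁ + b * s₂ ≤ t := by
    have := mul_le_mul_of_nonneg_left (le_max_left s₁ 0) hc.1
    have := mul_le_mul_of_nonneg_left (le_max_left s₂ 0) hc.2
    linarith
  refine ⟨H.exists_mem_of_le hχ hψ ⟨hpos, hle⟩, ?_⟩
  rw [abs_of_nonneg hφ]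
  linarith [H.anti hpos hle]

/-- The symmetrized profile is closed under great-circle arcs. -/
theorem symmetrization (H : ConvexProfile M w) {ψ₁ ψ₂ s₁ s₂ φ₁ φ₂ φ a b : ℝ}
    (h1 : M ψ₁ s₁) (h2 : M ψ₂ s₂) (hφ₁ : |φ₁| ≤ w s₁ / 2)
    (hφ₂ : |φ₂| ≤ w s₂ / 2) (hc : IsAngularComb φ₁ φ₂ φ a b) :
    (∃ ψ, M ψ (a * s₁ + b * s₂)) ∧ |φ| ≤ w (a * s₁ + b * s₂) / 2 := by
  rcases le_total 0 (a * s₁ + b * s₂) with h | h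
  · exact H.symmetrization_of_nonneg h1 h2 hφ₁ hφ₂ hc h
  · have := H.flip.symmetrization_of_nonneg (ψ₁ := ψ₁) (ψ₂ := ψ₂) (s₁ := -s₁) (s₂ := -s₂)
      (by simpa using h1) (by simpa using h2) (by simpa using hφ₁) (by simpa using hφ₂) hc
      (by linarith)
    rwa [show -(a * -s₁ + b * -s₂) = a * s₁ + b * s₂ by ring] at this

end ConvexProfile

/-! ### Passage between the sphere and the cylinder. -/

namespace Sph

variable (e : OrthonormalBasis (Fin 3) ℝ E3)

theorem mem_hemisphere_iff {p : S2} : p ∈ hemisphere e ↔ 0 < inner ℝ (e 0) (p : E3) := by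
  simp [hemisphere, openHemisphere, center, Real.arccos_lt_pi_div_two]

theorem sum_inner_sq (p : S2) :
    inner ℝ (e 0) (p : E3) ^ 2 + inner ℝ (e 1) (p : E3) ^ 2 + inner ℝ (e 2) (p : E3) ^ 2 = 1 := by
  have h := e.sum_sq_norm_inner_right (p : E3)
  rw [Fin.sum_univ_three] at h
  simpa using h

theorem ext_inner {p q : S2} (h : ∀ i, inner ℝ (e i) (p : E3) = inner ℝ (e i) (q : E3)) :
    p = q := by
  apply Subtype.ext
  apply e.repr.injective
  ext i
  simp only [e.repr_apply_apply, h]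

/-- The point with coordinates `φ` and `t = tan θ`. -/
noncomputable def cylPoint (φ t : ℝ) : S2 :=
  ⟨e.repr.symm ((√(1 + t ^ 2))⁻¹ • !₂[Real.cos φ, Real.sin φ, t]), by
    have h : 0 < √(1 + t ^ 2) := Real.sqrt_pos.2 (by positivity)
    rw [mem_sphere_zero_iff_norm, LinearIsometryEquiv.norm_map, norm_smul, norm_inv,
      Real.norm_of_nonneg h.le, inv_mul_eq_one₀ h.ne', EuclideanSpace.norm_eq]
    simp [Fin.sum_univ_three]⟩

theorem inner_cylPoint (φ t : ℝ) (i : Fin 3) :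
    inner ℝ (e i) (cylPoint e φ t : E3) =
      (√(1 + t ^ 2))⁻¹ * (![Real.cos φ, Real.sin φ, t] : Fin 3 → ℝ) i := by
  rw [← e.repr_apply_apply, cylPoint]
  simp

/-- `p` has coordinates `φ` and `t = tan θ`; its distance from the axis is `r`. -/
structure HasCoords (p : S2) (φ t r : ℝ) : Prop where
  pos : 0 < r
  abs_lt : |φ| < Real.pi / 2
  inner_zero : inner ℝ (e 0) (p : E3) = r * Real.cos φ
  inner_one : inner ℝ (e 1) (p : E3) = r * Real.sin φ
  inner_two : inner ℝ (e 2) (p : E3) = r * t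

variable {e}

theorem hasCoords_cylPoint {φ : ℝ} (t : ℝ) (h : |φ| < Real.pi / 2) :
    HasCoords e (cylPoint e φ t) φ t (√(1 + t ^ 2))⁻¹ :=
  ⟨inv_pos.2 (Real.sqrt_pos.2 (by positivity)), h, inner_cylPoint e φ t 0,
    inner_cylPoint e φ t 1, inner_cylPoint e φ t 2⟩

theorem hasCoords_of_mem {p : S2} (hp : p ∈ hemisphere e) :
    ∃ r, HasCoords e p (phi e p) (Real.tan (theta e p)) r := by
  rw [mem_hemisphere_iff] at hp
  have hsum := sum_inner_sq e p
  have hpos : 0 < 1 - inner ℝ (e 2) (p : E3) ^ 2 := by nlinarith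
  have hr := Real.sqrt_pos.2 hpos
  have hsq : √(1 + (inner ℝ (e 1) (p : E3) / inner ℝ (e 0) (p : E3)) ^ 2) =
      √(1 - inner ℝ (e 2) (p : E3) ^ 2) / inner ℝ (e 0) (p : E3) := by
    rw [Real.sqrt_eq_iff_mul_self_eq_of_pos (by positivity), ← pow_two, div_pow, Real.sq_sqrt hpos.le]
    field_simp
    linarith
  refine ⟨√(1 - inner ℝ (e 2) (p : E3) ^ 2), hr, ?_, ?_, ?_, ?_⟩
  · exact abs_lt.2 ⟨Real.neg_pi_div_two_lt_arctan _, Real.arctan_lt_pi_div_two _⟩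
  · rw [phi, Real.cos_arctan, hsq]
    field_simp
  · rw [phi, Real.sin_arctan, hsq]
    field_simp
  · rw [theta, Real.tan_arcsin]
    field_simp

namespace HasCoords

variable {p q : S2} {φ t r : ℝ}

theorem cos_pos (h : HasCoords e p φ t r) : 0 < Real.cos φ :=
  Real.cos_pos_of_mem_Ioo (_root_.abs_lt.1 h.abs_lt)

theorem mem_hemisphere (h : HasCoords e p φ t r) : p ∈ hemisphere e := by
  rw [mem_hemisphere_iff, h.inner_zero]
  exact mul_pos h.pos h.cos_pos

theorem radius_eq (h : HasCoords e p φ t r) : r = (√(1 + t ^ 2))⁻¹ := by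
  have hsum := sum_inner_sq e p
  rw [h.inner_zero, h.inner_one, h.inner_two] at hsum
  have : 1 + t ^ 2 = r⁻¹ ^ 2 := by
    have := h.pos
    field_simp
    linear_combination hsum - r ^ 2 * Real.sin_sq_add_cos_sq φ
  rw [this, Real.sqrt_sq (inv_pos.2 h.pos).le, inv_inv]

theorem phi_eq (h : HasCoords e p φ t r) : phi e p = φ := by
  have hφ := _root_.abs_lt.1 h.abs_lt
  rw [phi, h.inner_zero, h.inner_one, mul_div_mul_left _ _ h.pos.ne', ← Real.tan_eq_sin_div_cos,
    Real.arctan_tan hφ.1 hφ.2]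

theorem theta_eq (h : HasCoords e p φ t r) : theta e p = Real.arctan t := by
  rw [theta, h.inner_two, Real.arctan_eq_arcsin, h.radius_eq, inv_mul_eq_div]

theorem eq_cylPoint (h : HasCoords e p φ t r) : p = cylPoint e φ t := by
  refine ext_inner e fun i => ?_
  rw [inner_cylPoint, ← h.radius_eq]
  fin_cases i
  exacts [h.inner_zero, h.inner_one, h.inner_two]

theorem mem_distanceCurve (h : HasCoords e p φ t r) : p ∈ distanceCurve e (Real.arctan t) :=
  ⟨h.mem_hemisphere, h.theta_eq⟩

/-- The coordinates of a point of a spherical segment. -/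
theorem isAngularComb {z : S2} {φ₁ t₁ r₁ φ₂ t₂ r₂ : ℝ} (hp : HasCoords e p φ₁ t₁ r₁)
    (hq : HasCoords e q φ₂ t₂ r₂) (hz : z ∈ segment p q) :
    z ∈ hemisphere e ∧ ∃ a b, IsAngularComb φ₁ φ₂ (phi e z) a b ∧
      Real.tan (theta e z) = a * t₁ + b * t₂ := by
  obtain ⟨a, b, ha, hb, hab⟩ := hz
  have hi : ∀ i, inner ℝ (e i) (z : E3) =
      a * inner ℝ (e i) (p : E3) + b * inner ℝ (e i) (q : E3) := fun i => by
    rw [hab, inner_add_right, inner_smul_right, inner_smul_right]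
  have hp0 := (mem_hemisphere_iff e).1 hp.mem_hemisphere
  have hq0 := (mem_hemisphere_iff e).1 hq.mem_hemisphere
  have hz0 : z ∈ hemisphere e := by
    rw [mem_hemisphere_iff, hi]
    rcases ha.eq_or_lt with rfl | ha'
    · rcases hb.eq_or_lt with rfl | hb'
      · have h1 : ‖(z : E3)‖ = 1 := mem_sphere_zero_iff_norm.1 z.2
        rw [hab] at h1
        simp at h1
      · positivity
    · positivity
  obtain ⟨r, hr⟩ := hasCoords_of_mem hz0
  have hr0 := hr.pos
  -- The weights change because the cylinder vectors are the unit vectors divided by their distances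
  -- from the axis.
  refine ⟨hz0, a * r₁ / r, b * r₂ / r,
    ⟨div_nonneg (mul_nonneg ha hp.pos.le) hr0.le, div_nonneg (mul_nonneg hb hq.pos.le) hr0.le,
      hr.abs_lt, ?_, ?_⟩, ?_⟩
  · have := hi 0
    rw [hr.inner_zero, hp.inner_zero, hq.inner_zero] at this
    field_simp
    linarith
  · have := hi 1
    rw [hr.inner_one, hp.inner_one, hq.inner_one] at this
    field_simp
    linarith
  · have := hi 2
    rw [hr.inner_two, hp.inner_two, hq.inner_two] at this
    field_simp
    linarith

end HasCoords

theorem cylPoint_mem_segment {φ₁ t₁ φ₂ t₂ φ a b : ℝ} (hc : IsAngularComb φ₁ φ₂ φ a b) :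
    cylPoint e φ (a * t₁ + b * t₂) ∈ segment (cylPoint e φ₁ t₁) (cylPoint e φ₂ t₂) := by
  have h : ∀ t : ℝ, 0 < √(1 + t ^ 2) := fun t => Real.sqrt_pos.2 (by positivity)
  refine ⟨a * √(1 + t₁ ^ 2) / √(1 + (a * t₁ + b * t₂) ^ 2),
    b * √(1 + t₂ ^ 2) / √(1 + (a * t₁ + b * t₂) ^ 2),
    div_nonneg (mul_nonneg hc.1 (h _).le) (h _).le,
    div_nonneg (mul_nonneg hc.2 (h _).le) (h _).le, ?_⟩
  apply e.repr.injective
  ext i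
  rw [map_add, map_smul, map_smul, PiLp.add_apply, PiLp.smul_apply, PiLp.smul_apply,
    e.repr_apply_apply, e.repr_apply_apply, e.repr_apply_apply, inner_cylPoint, inner_cylPoint,
    inner_cylPoint, smul_eq_mul, smul_eq_mul]
  have h1 := (h t₁).ne'
  have h2 := (h t₂).ne'
  have h3 := (h (a * t₁ + b * t₂)).ne'
  set R := √(1 + (a * t₁ + b * t₂) ^ 2)
  fin_cases i
  · simp only [Fin.zero_eta, Matrix.cons_val_zero, hc.cos_eq]
    field_simp
  · simp only [Fin.mk_one, Matrix.cons_val_one, Matrix.cons_val_zero, hc.sin_eq]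
    field_simp
  · simp only [Fin.reduceFinMk, Matrix.cons_val]
    field_simp

theorem continuous_theta : Continuous (theta e) := by
  unfold theta
  fun_prop

theorem continuousOn_phi : ContinuousOn (phi e) (hemisphere e) := by
  unfold phi
  refine Real.continuous_arctan.comp_continuousOn (ContinuousOn.div ?_ ?_ fun p hp => ?_)
  · apply Continuous.continuousOn; fun_prop
  · apply Continuous.continuousOn; fun_prop
  · exact ((mem_hemisphere_iff e).1 hp).ne'

theorem continuous_cylPoint (t : ℝ) : Continuous fun φ => cylPoint e φ t := by
  unfold cylPoint
  refine Continuous.subtype_mk ?_ _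
  have h : Continuous fun φ => !₂[Real.cos φ, Real.sin φ, t] := by
    refine (PiLp.continuous_toLp 2 _).comp (continuous_pi fun i => ?_)
    fin_cases i
    · exact Real.continuous_cos
    · exact Real.continuous_sin
    · exact continuous_const
  exact e.repr.symm.continuous.comp (h.fun_const_smul _)

/-- A distance curve is not closed in the sphere, but within `K` it is cut out by the closed
condition `theta = t`. -/
theorem isCompact_phi_image {K : Set S2} (hK : IsCompact K) (hKS : K ⊆ hemisphere e) (t : ℝ) :
    IsCompact (phi e '' (K ∩ distanceCurve e t)) := by
  have h : K ∩ distanceCurve e t = K ∩ theta e ⁻¹' {t} :=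
    Set.ext fun p => ⟨fun h => ⟨h.1, h.2.2⟩, fun h => ⟨h.1, hKS h.1, h.2⟩⟩
  rw [h]
  exact (hK.inter_right (isClosed_singleton.preimage continuous_theta)).image_of_continuousOn
    (continuousOn_phi.mono fun p hp => hKS hp.1)

theorem mem_phi_image {K : Set S2} {φ t : ℝ} (hφ : |φ| < Real.pi / 2)
    (h : cylPoint e φ t ∈ K) : φ ∈ phi e '' (K ∩ distanceCurve e (Real.arctan t)) :=
  ⟨_, ⟨h, (hasCoords_cylPoint t hφ).mem_distanceCurve⟩, (hasCoords_cylPoint t hφ).phi_eq⟩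

theorem of_mem_phi_image {K : Set S2} {φ t : ℝ}
    (h : φ ∈ phi e '' (K ∩ distanceCurve e (Real.arctan t))) :
    |φ| < Real.pi / 2 ∧ cylPoint e φ t ∈ K := by
  obtain ⟨p, ⟨hp, hp0, hpt⟩, rfl⟩ := h
  obtain ⟨r, hr⟩ := hasCoords_of_mem hp0
  rw [hpt, Real.tan_arctan] at hr
  exact ⟨hr.abs_lt, hr.eq_cylPoint ▸ hp⟩

theorem convexProfile {K : Set S2} (hK : IsConvexBody K) (hKS : K ⊆ hemisphere e)
    (hmono : AngularMonotonicity e K) :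
    ConvexProfile (fun φ t => |φ| < Real.pi / 2 ∧ cylPoint e φ t ∈ K)
      (fun t => angularLength e (K ∩ distanceCurve e (Real.arctan t))) := by
  have hcomp := isCompact_phi_image hK.isCompact hKS
  have hsub : ∀ {φ ψ t : ℝ}, |φ| < Real.pi / 2 ∧ cylPoint e φ t ∈ K →
      |ψ| < Real.pi / 2 ∧ cylPoint e ψ t ∈ K →
      ψ - φ ≤ angularLength e (K ∩ distanceCurve e (Real.arctan t)) := by
    intro φ ψ t h1 h2
    refine (le_abs_self _).trans ?_
    rw [← Real.dist_eq]
    exact Metric.dist_le_diam_of_mem (hcomp _).isBounded (mem_phi_image h2.1 h2.2)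
      (mem_phi_image h1.1 h1.2)
  have hanti : ∀ {s t : ℝ}, 0 ≤ s → s ≤ t →
      angularLength e (K ∩ distanceCurve e (Real.arctan t)) ≤
        angularLength e (K ∩ distanceCurve e (Real.arctan s)) := fun {s t} h0 hst =>
    hmono.antitoneOn ⟨Real.arctan_nonneg.2 h0, Real.arctan_lt_pi_div_two _⟩
      ⟨Real.arctan_nonneg.2 (h0.trans hst), Real.arctan_lt_pi_div_two _⟩
      (Real.arctan_strictMono.monotone hst)
  have hmon : ∀ {s t : ℝ}, s ≤ t → t ≤ 0 →
      angularLength e (K ∩ distanceCurve e (Real.arctan s)) ≤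
        angularLength e (K ∩ distanceCurve e (Real.arctan t)) := fun {s t} hst h0 =>
    hmono.monotoneOn
      ⟨Real.neg_pi_div_two_lt_arctan _, Real.arctan_le_zero.2 (hst.trans h0)⟩
      ⟨Real.neg_pi_div_two_lt_arctan _, Real.arctan_le_zero.2 h0⟩
      (Real.arctan_strictMono.monotone hst)
  refine ⟨fun h => h.1, fun h1 h2 hc => ⟨hc.abs_lt, ?_⟩, hsub, ?_, hanti, hmon, ?_⟩
  · exact hK.isConvex.2 _ h1.2 _ h2.2 (cylPoint_mem_segment hc)
  · intro φ t h
    have hne : (phi e '' (K ∩ distanceCurve e (Real.arctan t))).Nonempty :=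
      ⟨φ, mem_phi_image h.1 h.2⟩
    exact ⟨_, _, of_mem_phi_image ((hcomp _).sInf_mem hne),
      of_mem_phi_image ((hcomp _).sSup_mem hne), (Real.diam_eq (hcomp _).isBounded).symm⟩
  -- An interior point gives a section of positive width, so by monotonicity the width at height `0`
  -- is positive. The empty set has diameter `0`, so that section is nonempty.
  · obtain ⟨p, hp⟩ := hK.nonempty_interior
    obtain ⟨r, hr⟩ := hasCoords_of_mem (hKS (interior_subset hp))
    set φ := phi e p
    set t := Real.tan (theta e p)
    have hev : ∀ᶠ ψ in nhds φ, |ψ| < Real.pi / 2 ∧ cylPoint e ψ t ∈ K := by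
      refine (continuous_abs.continuousAt.eventually_lt continuousAt_const hr.abs_lt).and ?_
      refine (continuous_cylPoint t).continuousAt.eventually ?_
      change ∀ᶠ q in nhds (cylPoint e φ t), q ∈ K
      rw [← hr.eq_cylPoint]
      exact mem_interior_iff_mem_nhds.1 hp
    obtain ⟨ψ, hψ, hlt⟩ := ((hev.filter_mono nhdsWithin_le_nhds).and
      (self_mem_nhdsWithin (a := φ) (s := Ioi φ))).exists
    have h1 := hsub hev.self_of_nhds hψ
    have h2 : angularLength e (K ∩ distanceCurve e (Real.arctan t)) ≤
        angularLength e (K ∩ distanceCurve e (Real.arctan 0)) := by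
      rcases le_total 0 t with h | h
      · exact hanti le_rfl h
      · exact hmon h le_rfl
    rcases (phi e '' (K ∩ distanceCurve e (Real.arctan 0))).eq_empty_or_nonempty with h0 | ⟨x, hx⟩
    · rw [angularLength, angularLength, h0, Metric.diam_empty, ← angularLength] at h2
      have : φ < ψ := hlt
      linarith
    · exact ⟨x, of_mem_phi_image hx⟩

end Sph

/-! ### The theorem, by transfer to the profile. -/

theorem mainTheorem5 (e : OrthonormalBasis (Fin 3) ℝ E3) (K : Set S2)
    (hK : Sph.IsConvexBody K) (hKS : K ⊆ Sph.hemisphere e)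
    (hmono : Sph.AngularMonotonicity e K) :
    Sph.IsConvex (Sph.steinerSymmetral e K) := by
  have H := Sph.convexProfile hK hKS hmono
  have key : ∀ x ∈ Sph.steinerSymmetral e K,
      ∃ r, Sph.HasCoords e x (Sph.phi e x) (Real.tan (Sph.theta e x)) r ∧
        (∃ ψ, |ψ| < Real.pi / 2 ∧ Sph.cylPoint e ψ (Real.tan (Sph.theta e x)) ∈ K) ∧
        |Sph.phi e x| ≤ Sph.angularLength e (K ∩ Sph.distanceCurve e
          (Real.arctan (Real.tan (Sph.theta e x)))) / 2 := by
    rintro x ⟨t, ⟨hx, rfl⟩, ⟨p, hp⟩, hle⟩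
    obtain ⟨r, hr⟩ := Sph.hasCoords_of_mem hx
    have ht : Real.arctan (Real.tan (Sph.theta e x)) = Sph.theta e x := hr.theta_eq.symm
    refine ⟨r, hr, ⟨Sph.phi e p, Sph.of_mem_phi_image ?_⟩, ?_⟩
    · rw [ht]
      exact ⟨p, hp, rfl⟩
    · rwa [ht]
  refine ⟨⟨Sph.center e, ?_⟩, ?_⟩
  · rintro x ⟨t, ⟨hx, -⟩, -⟩
    exact hx
  · intro x hx y hy z hz
    obtain ⟨r₁, c₁, ⟨ψ₁, h₁⟩, l₁⟩ := key x hx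
    obtain ⟨r₂, c₂, ⟨ψ₂, h₂⟩, l₂⟩ := key y hy
    obtain ⟨hzS, a, b, hc, ht⟩ := c₁.isAngularComb c₂ hz
    obtain ⟨⟨ψ, hψ⟩, hle⟩ := H.symmetrization h₁ h₂ l₁ l₂ hc
    rw [← ht] at hψ hle
    obtain ⟨r, hr⟩ := Sph.hasCoords_of_mem hzS
    have hq := Sph.hasCoords_cylPoint (e := e) (Real.tan (Sph.theta e z)) hψ.1
    refine ⟨_, hr.mem_distanceCurve, ⟨_, hψ.2, hq.mem_distanceCurve⟩, hle⟩
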